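/- Conventions. A Lipschitz seminorm on a unital $C^*$-algebra $A$ is a seminorm $L:A\to[0,\infty]$ with $L(a^*)=L(a)$, with $L(a)=0$ if and only if $a\in\mathbb{C}\mathbf 1_A$, and with $\mathrm{dom}(L)=\{a:L(a)<\infty\}$ dense in $A$. It is a Lip-norm, and $(A,L)$ is a compact quantum metric space, if the metric $\rho_L(\mu,\nu)=\sup\{|\mu(a)-\nu(a)|:a\in A,\ L(a)\le 1\}$ induces the weak$^*$-topology on the state space $\mathcal S(A)$. An inductive sequence $\{((A_n,L_{A_n}),\phi_n)\}_{n\ge1}$ of compact quantum metric spaces consists of compact quantum metric spaces $(A_n,L_{A_n})$ and unital $^*$-homomorphisms $\phi_n:A_n\to A_{n+1}$ with $\phi_n(\mathrm{dom}(L_{A_n}))\subset\mathrm{dom}(L_{A_{n+1}})$. Let $A=\varinjlim(A_n,\phi_n)$ be its $C^*$-algebraic inductive limit, with canonical unital $^*$-homomorphisms $\phi^n:A_n\to A$. For $\mu,\nu\in\mathcal S(A)$ put $$\rho(\mu,\nu)=\sum_{n=1}^\infty\frac1{2^n}\,\frac{\rho_{L_{A_n}}(\mu\circ\phi^n,\nu\circ\phi^n)}{1+\rho_{L_{A_n}}(\mu\circ\phi^n,\nu\circ\phi^n)},$$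 and equip $A$ with the seminorm $$L_A(a)=\sup\Big\{\frac{|\mu(a)-\nu(a)|}{\rho(\mu,\nu)}:\mu,\nu\in\mathcal S(A),\ \mu\ne\nu\Big\}\in[0,\infty].$$ In inequalities between values in $[0,\infty]$, $0\cdot\infty=0$. Statement. Let $\{((A_n,L_{A_n}),\phi_n)\}$ and $\{((B_n,L_{B_n}),\varphi_n)\}$ be two inductive sequences of compact quantum metric spaces, with inductive limits $A$ and $B$, canonical maps $\phi^n:A_n\to A$ and $\varphi^n:B_n\to B$, and seminorms $L_A$ and $L_B$ as above. Suppose that for each $n\ge 1$ there are unital $^*$-homomorphisms $\psi_n:A_n\to B_n$ and $\Psi_n:B_n\to A_{n+1}$ with $\Psi_n\circ\psi_n=\phi_n$ and $\psi_{n+1}\circ\Psi_n=\varphi_n$. Suppose further that there are bounded sequences $\{\lambda_n\},\{\gamma_n\},\{\alpha_n\},\{\beta_n\}$ of nonnegative real numbers such that, for all $n$, all $a\in A_n$ and all $b\in B_n$, $$L_{B_n}(\psi_n(a))\le\lambda_nL_{A_n}(a),\qquad L_B(\varphi^n(b))\le\gamma_nL_{B_n}(b),$$ $$L_{A_{n+1}}(\Psi_n(b))\le\alpha_nL_{B_n}(b),\qquad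 L_A(\phi^n(a))\le\beta_nL_{A_n}(a).$$ Then there are unital $^*$-homomorphisms $\psi:A\to B$ and $\Psi:B\to A$ such that 1. $\psi\circ\Psi=\mathrm{id}_B$ and $\Psi\circ\psi=\mathrm{id}_A$; 2. $\psi\circ\phi^n=\varphi^n\circ\psi_n$ and $\Psi\circ\varphi^n=\phi^{n+1}\circ\Psi_n$ for every $n\ge 1$; 3. $L_B(\psi(a))\le 2\sup\{\lambda_n\gamma_n:n\ge1\}\,L_A(a)$ for all $a\in A$; 4. $L_A(\Psi(b))\le 2\sup\{\alpha_n\beta_{n+1}:n\ge1\}\,L_B(b)$ for all $b\in B$. -/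

import Mathlib

open scoped NNReal ENNReal Topology ComplexOrder
open Filter UniformSpace

noncomputable section

/-! ## The inductive limit of a sequence of unital C*-algebras -/

section InductiveLimit

universe u

variable {A : ℕ → Type u} [∀ n, CStarAlgebra (A n)]

/-- The composite `φ_{k-1} ∘ ⋯ ∘ φ_n : A_n → A_k` of connecting maps, for `n ≤ k`. -/
def connecting (φ : ∀ n, A n →⋆ₐ[ℂ] A (n + 1)) {n k : ℕ} (h : n ≤ k) : A n →⋆ₐ[ℂ] A k :=
  Nat.leRecOn (C := fun k => A n →⋆ₐ[ℂ] A k) h (fun {k} f => (φ k).comp f)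
    (StarAlgHom.id ℂ (A n))

theorem connecting_self (φ : ∀ n, A n →⋆ₐ[ℂ] A (n + 1)) (n : ℕ) (a : A n) :
    connecting φ (le_refl n) a = a := by
  simp [connecting, Nat.leRecOn_self]

theorem connecting_succ (φ : ∀ n, A n →⋆ₐ[ℂ] A (n + 1)) {n k : ℕ} (h : n ≤ k) (a : A n) :
    connecting φ (Nat.le_succ_of_le h) a = φ k (connecting φ h a) := by
  simp only [connecting]
  rw [Nat.leRecOn_succ h]
  rfl

/-- The *-algebra of all sequences `(a_k)` in `∏ A_k` with `a_{k+1} = φ_k(a_k)` for all large `k`. -/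
def coherentSubalgebra (φ : ∀ n, A n →⋆ₐ[ℂ] A (n + 1)) : StarSubalgebra ℂ (∀ k, A k) where
  carrier := {a | ∀ᶠ k in atTop, a (k + 1) = φ k (a k)}
  mul_mem' ha hb := by
    filter_upwards [ha, hb] with k h₁ h₂
    simp [h₁, h₂]
  add_mem' ha hb := by
    filter_upwards [ha, hb] with k h₁ h₂
    simp [h₁, h₂]
  algebraMap_mem' c := by
    refine Eventually.of_forall fun k => ?_
    simp [Pi.algebraMap_apply, AlgHomClass.commutes]
  star_mem' ha := by
    filter_upwards [ha] with k h₁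
    simp [h₁, map_star]

/-- The same *-algebra as a bare type, without the product topology. -/
def PreLimit (φ : ∀ n, A n →⋆ₐ[ℂ] A (n + 1)) : Type u := coherentSubalgebra φ

namespace PreLimit

variable (φ : ∀ n, A n →⋆ₐ[ℂ] A (n + 1))

instance : Ring (PreLimit φ) := inferInstanceAs (Ring (coherentSubalgebra φ))
instance : StarRing (PreLimit φ) := inferInstanceAs (StarRing (coherentSubalgebra φ))
instance : Algebra ℂ (PreLimit φ) := inferInstanceAs (Algebra ℂ (coherentSubalgebra φ))
instance : StarModule ℂ (PreLimit φ) := inferInstanceAs (StarModule ℂ (coherentSubalgebra φ))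

variable {φ}

/-- The `k`-th entry of a sequence. -/
def entry (x : PreLimit φ) (k : ℕ) : A k := x.1 k

theorem entry_coherent (x : PreLimit φ) : ∀ᶠ k in atTop, x.entry (k + 1) = φ k (x.entry k) := x.2

@[simp] theorem entry_zero (k : ℕ) : (0 : PreLimit φ).entry k = 0 := rfl
@[simp] theorem entry_one (k : ℕ) : (1 : PreLimit φ).entry k = 1 := rfl
@[simp] theorem entry_add (x y : PreLimit φ) (k : ℕ) :
    (x + y).entry k = x.entry k + y.entry k := rfl
@[simp] theorem entry_neg (x : PreLimit φ) (k : ℕ) : (-x).entry k = -x.entry k := rfl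
@[simp] theorem entry_mul (x y : PreLimit φ) (k : ℕ) :
    (x * y).entry k = x.entry k * y.entry k := rfl
@[simp] theorem entry_star (x : PreLimit φ) (k : ℕ) : (star x).entry k = star (x.entry k) := rfl
@[simp] theorem entry_smul (c : ℂ) (x : PreLimit φ) (k : ℕ) : (c • x).entry k = c • x.entry k := rfl

@[ext] theorem ext {x y : PreLimit φ} (h : ∀ k, x.entry k = y.entry k) : x = y :=
  Subtype.ext (funext h)

/-- The seminorm `lim ‖a_k‖` on eventually coherent sequences. -/
def limNorm (x : PreLimit φ) : ℝ := limUnder atTop fun k => ‖x.entry k‖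

/-- The limit defining `limNorm` exists. -/
theorem tendsto_limNorm (x : PreLimit φ) :
    Tendsto (fun k => ‖x.entry k‖) atTop (𝓝 x.limNorm) := by
  apply tendsto_nhds_limUnder
  obtain ⟨N, hN⟩ := eventually_atTop.1 x.entry_coherent
  have hanti : Antitone fun j => ‖x.entry (j + N)‖ := by
    refine antitone_nat_of_succ_le fun j => ?_
    have h := hN (j + N) (by omega)
    have e : j + 1 + N = j + N + 1 := by omega
    rw [e, h]
    exact NonUnitalStarAlgHom.norm_apply_le (φ (j + N)) _
  have hb : BddBelow (Set.range fun j => ‖x.entry (j + N)‖) :=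
    ⟨0, by rintro _ ⟨j, rfl⟩; exact norm_nonneg _⟩
  exact ⟨_, (tendsto_add_atTop_iff_nat N).1 (tendsto_atTop_ciInf hanti hb)⟩

/-- `limNorm` as a seminorm on the ring of eventually coherent sequences. -/
def ringSeminorm (φ : ∀ n, A n →⋆ₐ[ℂ] A (n + 1)) : RingSeminorm (PreLimit φ) where
  toFun := limNorm
  map_zero' := tendsto_nhds_unique (tendsto_limNorm (0 : PreLimit φ)) (by simp)
  add_le' x y := le_of_tendsto_of_tendsto' (tendsto_limNorm (x + y))
    ((tendsto_limNorm x).add (tendsto_limNorm y)) fun k => norm_add_le _ _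
  neg' x := tendsto_nhds_unique (tendsto_limNorm (-x)) (by simpa using! tendsto_limNorm x)
  mul_le' x y := le_of_tendsto_of_tendsto' (tendsto_limNorm (x * y))
    ((tendsto_limNorm x).mul (tendsto_limNorm y)) fun k => norm_mul_le _ _

instance : SeminormedRing (PreLimit φ) := (ringSeminorm φ).toSeminormedRing

theorem tendsto_norm (x : PreLimit φ) : Tendsto (fun k => ‖x.entry k‖) atTop (𝓝 ‖x‖) :=
  tendsto_limNorm x

instance : NormedAlgebra ℂ (PreLimit φ) where
  norm_smul_le c x := le_of_tendsto_of_tendsto' (tendsto_norm (c • x))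
    ((tendsto_norm x).const_mul ‖c‖) fun k => by rw [entry_smul, norm_smul]

instance : NormedStarGroup (PreLimit φ) where
  norm_star_le x := le_of_tendsto_of_tendsto' (tendsto_norm (star x)) (tendsto_norm x)
    fun _ => by simp

theorem norm_mul_self_le (x : PreLimit φ) : ‖x‖ * ‖x‖ ≤ ‖star x * x‖ :=
  le_of_tendsto_of_tendsto' ((tendsto_norm x).mul (tendsto_norm x))
    (tendsto_norm (star x * x)) fun _ => CStarRing.norm_mul_self_le _

/-- The sequence `(0, …, 0, a, φ_n(a), φ_{n+1}(φ_n(a)), …)` with `a` at place `n`. -/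
def single (n : ℕ) (a : A n) : PreLimit φ :=
  ⟨fun k => if h : n ≤ k then connecting φ h a else 0, by
    filter_upwards [eventually_ge_atTop n] with k hk
    simp only [hk, Nat.le_succ_of_le hk, dite_true]
    exact connecting_succ φ hk a⟩

theorem entry_single (n : ℕ) (a : A n) {k : ℕ} (h : n ≤ k) :
    (single n a : PreLimit φ).entry k = connecting φ h a := by
  simp [entry, single, h]

end PreLimit

/-- The inductive limit C*-algebra `A = lim (A_n, φ_n)`: the Hausdorff completion of the *-algebra
of eventually coherent sequences for the C*-seminorm `lim ‖a_k‖`. -/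
def InductiveLimit (φ : ∀ n, A n →⋆ₐ[ℂ] A (n + 1)) : Type u := Completion (PreLimit φ)

namespace InductiveLimit

variable {φ : ∀ n, A n →⋆ₐ[ℂ] A (n + 1)}

instance : NormedRing (InductiveLimit φ) := inferInstanceAs (NormedRing (Completion (PreLimit φ)))
instance : CompleteSpace (InductiveLimit φ) :=
  inferInstanceAs (CompleteSpace (Completion (PreLimit φ)))
instance : Algebra ℂ (InductiveLimit φ) :=
  inferInstanceAs (Algebra ℂ (Completion (PreLimit φ)))

/-- The canonical map from eventually coherent sequences to the inductive limit. -/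
def mk (x : PreLimit φ) : InductiveLimit φ := (x : Completion (PreLimit φ))

theorem norm_mk (x : PreLimit φ) : ‖mk x‖ = ‖x‖ := Completion.norm_coe x
theorem continuous_mk : Continuous (mk (φ := φ)) := Completion.continuous_coe _
theorem denseRange_mk : DenseRange (mk (φ := φ)) := Completion.denseRange_coe
theorem mk_add (x y : PreLimit φ) : mk (x + y) = mk x + mk y := Completion.coe_add x y
theorem mk_sub (x y : PreLimit φ) : mk (x - y) = mk x - mk y := Completion.coe_sub x y
theorem mk_mul (x y : PreLimit φ) : mk (x * y) = mk x * mk y := Completion.coe_mul x y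
theorem mk_one : mk (1 : PreLimit φ) = 1 := rfl
theorem mk_zero : mk (0 : PreLimit φ) = 0 := rfl
theorem mk_smul (c : ℂ) (x : PreLimit φ) : mk (c • x) = c • mk x := Completion.coe_smul c x

theorem mk_induction {p : InductiveLimit φ → Prop} (a : InductiveLimit φ)
    (hp : IsClosed {a | p a}) (h : ∀ x, p (mk x)) : p a :=
  Completion.induction_on a hp h

theorem mk_eq_of_eventually {x y : PreLimit φ} (h : ∀ᶠ k in atTop, x.entry k = y.entry k) :
    mk x = mk y := by
  rw [← sub_eq_zero, ← norm_eq_zero, ← mk_sub, norm_mk, sub_eq_add_neg]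
  refine tendsto_nhds_unique (PreLimit.tendsto_norm _) ?_
  refine tendsto_const_nhds.congr' ?_
  filter_upwards [h] with k hk
  simp [hk]

instance : Star (InductiveLimit φ) := ⟨Completion.map (star : PreLimit φ → PreLimit φ)⟩

theorem continuous_star' : Continuous fun a : InductiveLimit φ => star a :=
  Completion.continuous_map

theorem mk_star (x : PreLimit φ) : mk (star x) = star (mk x) :=
  (Completion.map_coe (star_isometry (E := PreLimit φ)).uniformContinuous x).symm

instance : NormedAlgebra ℂ (InductiveLimit φ) where
  norm_smul_le c a := by
    exact norm_smul_le (β := Completion (PreLimit φ)) c a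

instance : StarRing (InductiveLimit φ) where
  star_involutive a := by
    refine mk_induction (p := fun a => star (star a) = a) a ?_ fun x => ?_
    · exact isClosed_eq (continuous_star'.comp continuous_star') continuous_id
    · rw [← mk_star, ← mk_star, star_star]
  star_mul a b := by
    refine mk_induction a (isClosed_eq (continuous_star'.comp (continuous_mul_const b))
      ((continuous_const_mul (star b)).comp continuous_star')) fun x => ?_
    refine mk_induction b (isClosed_eq (continuous_star'.comp (continuous_const_mul (mk x)))
      ((continuous_mul_const (star (mk x))).comp continuous_star')) fun y => ?_
    simp only [Function.comp]
    rw [← mk_mul, ← mk_star, ← mk_star, ← mk_star, star_mul, mk_mul]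
  star_add a b := by
    refine mk_induction a (isClosed_eq (continuous_star'.comp (continuous_add_const b))
      ((continuous_add_const (star b)).comp continuous_star')) fun x => ?_
    refine mk_induction b (isClosed_eq (continuous_star'.comp (continuous_const_add (mk x)))
      ((continuous_const_add (star (mk x))).comp continuous_star')) fun y => ?_
    simp only [Function.comp]
    rw [← mk_add, ← mk_star, ← mk_star, ← mk_star, star_add, mk_add]

instance : CStarRing (InductiveLimit φ) where
  norm_mul_self_le a := by
    refine mk_induction (p := fun a => ‖a‖ * ‖a‖ ≤ ‖star a * a‖) a ?_ fun x => ?_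
    · exact isClosed_le (by fun_prop) (continuous_norm.comp (continuous_star'.mul continuous_id))
    · rw [← mk_star, ← mk_mul, norm_mk, norm_mk]
      exact PreLimit.norm_mul_self_le x

instance : StarModule ℂ (InductiveLimit φ) where
  star_smul c a := by
    refine mk_induction (p := fun a => star (c • a) = star c • star a) a ?_ fun x => ?_
    · exact isClosed_eq (continuous_star'.comp (continuous_const_smul c))
        ((continuous_const_smul (star c)).comp continuous_star')
    · rw [← mk_smul, ← mk_star, ← mk_star, star_smul, mk_smul]

instance : CStarAlgebra (InductiveLimit φ) where

/-- The canonical unital *-homomorphism `φ^n : A_n → lim (A_n, φ_n)`. -/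
def of (φ : ∀ n, A n →⋆ₐ[ℂ] A (n + 1)) (n : ℕ) : A n →⋆ₐ[ℂ] InductiveLimit φ where
  toFun a := mk (PreLimit.single n a)
  map_one' := by
    rw [← mk_one]
    apply mk_eq_of_eventually
    filter_upwards [eventually_ge_atTop n] with k hk
    simp [PreLimit.entry_single n _ hk]
  map_mul' a b := by
    rw [← mk_mul]
    apply mk_eq_of_eventually
    filter_upwards [eventually_ge_atTop n] with k hk
    simp [PreLimit.entry_single n _ hk]
  map_zero' := by
    rw [← mk_zero]
    apply mk_eq_of_eventually
    filter_upwards [eventually_ge_atTop n] with k hk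
    simp [PreLimit.entry_single n _ hk]
  map_add' a b := by
    rw [← mk_add]
    apply mk_eq_of_eventually
    filter_upwards [eventually_ge_atTop n] with k hk
    simp [PreLimit.entry_single n _ hk]
  commutes' c := by
    rw [Algebra.algebraMap_eq_smul_one, Algebra.algebraMap_eq_smul_one, ← mk_one, ← mk_smul]
    apply mk_eq_of_eventually
    filter_upwards [eventually_ge_atTop n] with k hk
    simp [PreLimit.entry_single n _ hk]
  map_star' a := by
    rw [← mk_star]
    apply mk_eq_of_eventually
    filter_upwards [eventually_ge_atTop n] with k hk
    simp [PreLimit.entry_single n _ hk, map_star]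

/-- `φ^{n+1} ∘ φ_n = φ^n`. -/
theorem of_succ_apply (n : ℕ) (a : A n) : of φ (n + 1) (φ n a) = of φ n a := by
  apply mk_eq_of_eventually
  filter_upwards [eventually_ge_atTop (n + 1)] with k hk
  rw [PreLimit.entry_single _ _ hk, PreLimit.entry_single _ _ (Nat.le_of_succ_le hk)]
  induction k, hk using Nat.le_induction with
  | base => rw [connecting_self, connecting_succ φ (le_refl n), connecting_self]
  | succ k hk ih => rw [connecting_succ φ hk, ih, connecting_succ φ (Nat.le_of_succ_le hk)]

/-- `‖φ^n(a)‖ = lim_k ‖φ_{k-1}(⋯ φ_n(a))‖`. -/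
theorem tendsto_norm_of (n : ℕ) (a : A n) :
    Tendsto (fun j => ‖connecting φ (Nat.le_add_right n j) a‖) atTop (𝓝 ‖of φ n a‖) := by
  have h : Tendsto (fun j => ‖(PreLimit.single n a : PreLimit φ).entry (n + j)‖) atTop
      (𝓝 ‖(PreLimit.single n a : PreLimit φ)‖) :=
    (PreLimit.tendsto_norm _).comp (tendsto_add_atTop_nat n |>.congr fun j => by omega)
  rw [← norm_mk] at h
  exact h.congr fun j => by rw [PreLimit.entry_single n a (Nat.le_add_right n j)]

/-- The union of the images of the `A_n` is dense in the inductive limit. -/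
theorem dense_iUnion_range_of : Dense (⋃ n, Set.range (of φ n)) := by
  refine denseRange_mk.mono ?_
  rintro _ ⟨x, rfl⟩
  obtain ⟨N, hN⟩ := eventually_atTop.1 x.entry_coherent
  refine Set.mem_iUnion.2 ⟨N, x.entry N, ?_⟩
  apply mk_eq_of_eventually
  filter_upwards [eventually_ge_atTop N] with k hk
  rw [PreLimit.entry_single _ _ hk]
  induction k, hk using Nat.le_induction with
  | base => rw [connecting_self]
  | succ k hk ih => rw [connecting_succ φ hk, ih, hN k hk]

end InductiveLimit

end InductiveLimit

/-! ## Compact quantum metric spaces -/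

section QuantumMetric

universe u

/-- The state space of a unital C*-algebra with the weak* topology (as a subspace of the weak
dual): the positive linear functionals with value `1` at the identity. -/
def StateSpace (A : Type u) [CStarAlgebra A] : Set (WeakDual ℂ A) :=
  {μ | μ 1 = 1 ∧ ∀ a : A, 0 ≤ μ (star a * a)}

/-- The pullback `μ ↦ μ ∘ f` of a linear functional along a unital *-homomorphism. -/
def pullback {A B : Type u} [CStarAlgebra A] [CStarAlgebra B] (f : A →⋆ₐ[ℂ] B)
    (μ : WeakDual ℂ B) : WeakDual ℂ A :=
  StrongDual.toWeakDual ((WeakDual.toStrongDual μ).comp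
    { toLinearMap := f.toAlgHom.toLinearMap
      cont := AddMonoidHomClass.continuous_of_bound f 1 fun a => by
        simpa using! NonUnitalStarAlgHom.norm_apply_le f a })

theorem pullback_apply {A B : Type u} [CStarAlgebra A] [CStarAlgebra B] (f : A →⋆ₐ[ℂ] B)
    (μ : WeakDual ℂ B) (a : A) : pullback f μ a = μ (f a) := rfl

/-- A Lipschitz seminorm on a unital C*-algebra, with the value `∞` permitted. -/
structure IsLipschitzSeminorm {A : Type u} [CStarAlgebra A] (L : A → ℝ≥0∞) : Prop where
  add_le : ∀ a b, L (a + b) ≤ L a + L b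
  smul : ∀ (c : ℂ) (a : A), L (c • a) = ‖c‖ₑ * L a
  star : ∀ a, L (star a) = L a
  eq_zero_iff : ∀ a, L a = 0 ↔ ∃ c : ℂ, a = algebraMap ℂ A c
  dense_dom : Dense {a | L a < ∞}

/-- The Monge-Kantorovich metric `ρ_L(μ, ν) = sup {|μ(a) - ν(a)| : L(a) ≤ 1}`. -/
def mongeKantorovich {A : Type u} [CStarAlgebra A] (L : A → ℝ≥0∞) (μ ν : WeakDual ℂ A) : ℝ≥0∞ :=
  ⨆ (a : A) (_ : L a ≤ 1), ‖μ a - ν a‖ₑ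

/-- A Lip-norm on `A`, i.e. `(A, L)` is a compact quantum metric space: a Lipschitz seminorm such
that the topology on the state space induced by the Monge-Kantorovich metric (a set is open iff it
contains a metric ball around each of its points) is the weak* topology. -/
structure IsLipNorm {A : Type u} [CStarAlgebra A] (L : A → ℝ≥0∞) : Prop
    extends IsLipschitzSeminorm L where
  isOpen_iff : ∀ U : Set (StateSpace A), IsOpen U ↔
    ∀ μ ∈ U, ∃ ε : ℝ≥0∞, 0 < ε ∧ ∀ ν : StateSpace A, mongeKantorovich L μ ν < ε → ν ∈ U

variable {A : ℕ → Type u} [∀ n, CStarAlgebra (A n)]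

/-- An inductive sequence of compact quantum metric spaces: the connecting unital
*-homomorphisms preserve Lipschitz elements. -/
structure IsInductiveSequence (L : ∀ n, A n → ℝ≥0∞) (φ : ∀ n, A n →⋆ₐ[ℂ] A (n + 1)) : Prop where
  isLipNorm : ∀ n, IsLipNorm (L n)
  map_dom : ∀ n a, L n a < ∞ → L (n + 1) (φ n a) < ∞

/-- The metric `ρ(μ, ν) = ∑_n 2^{-n} ρ_{L_n}(μ_n, ν_n) / (1 + ρ_{L_n}(μ_n, ν_n))`, where
`μ_n = μ ∘ φ^n`, on states of the inductive limit. The algebras are indexed from `0` here, whence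
the weight `2^{-(n+1)}`. The metrics `ρ_{L_n}` of Lip-norms are finite on states. -/
def limitMetric (L : ∀ n, A n → ℝ≥0∞) (φ : ∀ n, A n →⋆ₐ[ℂ] A (n + 1))
    (μ ν : WeakDual ℂ (InductiveLimit φ)) : ℝ≥0∞ :=
  ∑' n : ℕ, (2⁻¹ : ℝ≥0∞) ^ (n + 1) *
    (mongeKantorovich (L n) (pullback (InductiveLimit.of φ n) μ)
        (pullback (InductiveLimit.of φ n) ν) /
      (1 + mongeKantorovich (L n) (pullback (InductiveLimit.of φ n) μ)
        (pullback (InductiveLimit.of φ n) ν)))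

/-- The seminorm `L(a) = sup {|μ(a) - ν(a)| / ρ(μ, ν) : μ ≠ ν states}` on the inductive limit. -/
def limitSeminorm (L : ∀ n, A n → ℝ≥0∞) (φ : ∀ n, A n →⋆ₐ[ℂ] A (n + 1))
    (a : InductiveLimit φ) : ℝ≥0∞ :=
  ⨆ (μ : StateSpace (InductiveLimit φ)) (ν : StateSpace (InductiveLimit φ)) (_ : μ ≠ ν),
    ‖μ.1 a - ν.1 a‖ₑ / limitMetric L φ μ ν

end QuantumMetric

end

/-! The relations `Ψ n ∘ ψ n = φ n` and `ψ (n + 1) ∘ Ψ n = θ n` form an approximate-free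
intertwining: the maps `of θ n ∘ ψ n` and `of φ (n + 1) ∘ Ψ n` are compatible with the connecting
maps, so the universal property `lift` gives homomorphisms between the limits. They are mutually
inverse because they are so on the images of the `A n` and `B n`, whose union is dense
(`starAlgHom_ext`).

The Lipschitz bounds are proved by duality in `limitSeminorm_map_le`. Suppose `f` satisfies `L_B (f
(φ^n x)) ≤ K L_n x` for all `n` and `x`. For states `μ`, `ν` of `B`, testing on `L_n x ≤ 1` bounds
each distance between the restrictions of `μ ∘ f` and `ν ∘ f` to `A n` by `K ρ_B(μ, ν)`. Since `x /
(1 + x) ≤ x` and the weights sum to `1`, also `ρ_A(μ ∘ f, ν ∘ f) ≤ K ρ_B(μ, ν)`, whence `|μ (f a) -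
ν (f a)| ≤ K L_A(a) ρ_B(μ, ν)`. Chaining the hypotheses gives `K = sup (lam n * gam n)`, and
similarly for the inverse, without the factor 2.

The inequality `|μ a - ν a| ≤ L_A(a) ρ_A(μ, ν)` requires that `ρ_A` be finite and separate states.
Separation rests on the finiteness of each `ρ_{L_n}` on states, which follows from connectedness of
segments in the state space. -/

noncomputable section

/-! ### Universal property of the inductive limit -/

namespace InductiveLimit

universe u v

variable {A : ℕ → Type u} [∀ n, CStarAlgebra (A n)] {φ : ∀ n, A n →⋆ₐ[ℂ] A (n + 1)}
  {C : Type v} [CStarAlgebra C]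

theorem continuous_starAlgHom {D : Type u} [CStarAlgebra D] (f : D →⋆ₐ[ℂ] C) : Continuous f :=
  AddMonoidHomClass.continuous_of_bound f 1 fun a => by
    simpa using! NonUnitalStarAlgHom.norm_apply_le f a

/-- Star homomorphisms out of the inductive limit that agree on every `A_n` are equal. -/
theorem starAlgHom_ext {f g : InductiveLimit φ →⋆ₐ[ℂ] C}
    (h : ∀ n a, f (of φ n a) = g (of φ n a)) : f = g := by
  refine DFunLike.coe_injective ?_
  refine Continuous.ext_on dense_iUnion_range_of (continuous_starAlgHom f)
    (continuous_starAlgHom g) ?_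
  rintro _ hx
  obtain ⟨n, a, rfl⟩ := Set.mem_iUnion.1 hx
  exact h n a

section Lift

variable (g : ∀ n, A n →⋆ₐ[ℂ] C)

/-- The eventual value of `g_k(x_k)` for an eventually coherent sequence `x`. -/
def preLiftFun (x : PreLimit φ) : C := limUnder atTop fun k => g k (x.entry k)

variable {g} (hg : ∀ n a, g (n + 1) (φ n a) = g n a)
include hg

/-- Compatibility of the `g k` makes `g k (x.entry k)` constant once `x` is coherent. Algebraic
identities for the limit value can thus be checked at a single large index. -/
theorem eventually_eq_preLiftFun (x : PreLimit φ) :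
    ∀ᶠ k in atTop, g k (x.entry k) = preLiftFun g x := by
  obtain ⟨N, hN⟩ := eventually_atTop.1 x.entry_coherent
  have hc : ∀ k ≥ N, g k (x.entry k) = g N (x.entry N) := by
    intro k hk
    induction k, hk using Nat.le_induction with
    | base => rfl
    | succ k hk ih => rw [hN k hk, hg, ih]
  have hev : ∀ᶠ k in atTop, g k (x.entry k) = g N (x.entry N) := eventually_atTop.2 ⟨N, hc⟩
  have ht : Tendsto (fun k => g k (x.entry k)) atTop (𝓝 (g N (x.entry N))) :=
    tendsto_const_nhds.congr' (hev.mono fun _ h => h.symm)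
  filter_upwards [hev] with k hk
  rw [hk, preLiftFun, ht.limUnder_eq]

theorem preLiftFun_eq {x : PreLimit φ} {c : C}
    (h : ∀ᶠ k in atTop, g k (x.entry k) = c) : preLiftFun g x = c := by
  obtain ⟨k, h₁, h₂⟩ := ((eventually_eq_preLiftFun hg x).and h).exists
  rw [← h₁, h₂]

/-- Each `g k` is contractive and `‖x‖` is the limit of the norms of the entries. This bound allows
the extension to the completion. -/
theorem norm_preLiftFun_le (x : PreLimit φ) : ‖preLiftFun g x‖ ≤ ‖x‖ := by
  refine ge_of_tendsto (PreLimit.tendsto_norm x) ?_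
  filter_upwards [eventually_eq_preLiftFun hg x] with k hk
  rw [← hk]
  exact NonUnitalStarAlgHom.norm_apply_le (g k) _

/-- The map induced on eventually coherent sequences by a compatible family. -/
def preLift : PreLimit φ →+* C where
  toFun := preLiftFun g
  map_one' := preLiftFun_eq hg (.of_forall fun k => by simp)
  map_zero' := preLiftFun_eq hg (.of_forall fun k => by simp)
  map_add' x y := preLiftFun_eq hg <| by
    filter_upwards [eventually_eq_preLiftFun hg x, eventually_eq_preLiftFun hg y] with k h₁ h₂
    simp [h₁, h₂]
  map_mul' x y := preLiftFun_eq hg <| by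
    filter_upwards [eventually_eq_preLiftFun hg x, eventually_eq_preLiftFun hg y] with k h₁ h₂
    simp [h₁, h₂]

theorem continuous_preLift : Continuous (preLift hg) :=
  AddMonoidHomClass.continuous_of_bound (preLift hg) 1 fun x => by
    rw [one_mul]
    exact norm_preLiftFun_le hg x

/-- The ring homomorphism underlying `lift`. -/
def liftRingHom : InductiveLimit φ →+* C :=
  Completion.extensionHom (preLift hg) (continuous_preLift hg)

theorem continuous_liftRingHom : Continuous (liftRingHom hg) :=
  Completion.continuous_extension

theorem liftRingHom_mk (x : PreLimit φ) : liftRingHom hg (mk x) = preLiftFun g x :=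
  Completion.extensionHom_coe (preLift hg) (continuous_preLift hg) x

theorem liftRingHom_of (n : ℕ) (a : A n) : liftRingHom hg (of φ n a) = g n a := by
  refine (liftRingHom_mk hg _).trans (preLiftFun_eq hg ?_)
  filter_upwards [eventually_ge_atTop n] with k hk
  rw [PreLimit.entry_single _ _ hk]
  induction k, hk using Nat.le_induction with
  | base => rw [connecting_self]
  | succ k hk ih => rw [connecting_succ φ hk, hg, ih]

/-- The universal property of the inductive limit. -/
def lift : InductiveLimit φ →⋆ₐ[ℂ] C where
  __ := liftRingHom hg
  commutes' c := by
    -- Scalars of the limit are images of scalars of `A 0`, so linearity is inherited from `g 0`.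
    have h := liftRingHom_of hg 0 (algebraMap ℂ (A 0) c)
    rw [AlgHomClass.commutes (of φ 0), AlgHomClass.commutes (g 0)] at h
    exact h
  map_star' a := by
    refine mk_induction (p := fun a => liftRingHom hg (star a) = star (liftRingHom hg a)) a ?_
      fun x => ?_
    · exact isClosed_eq ((continuous_liftRingHom hg).comp continuous_star')
        (continuous_star.comp (continuous_liftRingHom hg))
    · rw [← mk_star, liftRingHom_mk, liftRingHom_mk]
      refine preLiftFun_eq hg ?_
      filter_upwards [eventually_eq_preLiftFun hg x] with k hk
      simp [map_star, hk]

theorem lift_of (n : ℕ) (a : A n) : lift hg (of φ n a) = g n a := liftRingHom_of hg n a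

end Lift

end InductiveLimit

/-! ### States and the Monge-Kantorovich metric -/

section States

universe u v

variable {A : Type u} [CStarAlgebra A]

theorem mongeKantorovich_triangle (L : A → ℝ≥0∞) (μ ν κ : WeakDual ℂ A) :
    mongeKantorovich L μ κ ≤ mongeKantorovich L μ ν + mongeKantorovich L ν κ := by
  refine iSup₂_le fun a ha => ?_
  calc ‖μ a - κ a‖ₑ = ‖(μ a - ν a) + (ν a - κ a)‖ₑ := by rw [sub_add_sub_cancel]
    _ ≤ ‖μ a - ν a‖ₑ + ‖ν a - κ a‖ₑ := enorm_add_le _ _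
    _ ≤ _ := add_le_add (le_iSup₂ (f := fun a (_ : L a ≤ 1) => ‖μ a - ν a‖ₑ) a ha)
        (le_iSup₂ (f := fun a (_ : L a ≤ 1) => ‖ν a - κ a‖ₑ) a ha)

/-- The point `(1 - t) μ + t ν` of the segment from `μ` to `ν`. -/
def functionalSegment (μ ν : WeakDual ℂ A) (t : ℝ) : WeakDual ℂ A := μ + (t : ℂ) • (ν - μ)

theorem functionalSegment_apply (μ ν : WeakDual ℂ A) (t : ℝ) (a : A) :
    functionalSegment μ ν t a = μ a + t * (ν a - μ a) := rfl

theorem functionalSegment_mem {μ ν : WeakDual ℂ A} (hμ : μ ∈ StateSpace A) (hν : ν ∈ StateSpace A)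
    {t : ℝ} (h₀ : 0 ≤ t) (h₁ : t ≤ 1) : functionalSegment μ ν t ∈ StateSpace A := by
  refine ⟨by rw [functionalSegment_apply, hμ.1, hν.1]; simp, fun a => ?_⟩
  have e : functionalSegment μ ν t (star a * a) =
      ((1 - t : ℝ) : ℂ) * μ (star a * a) + (t : ℂ) * ν (star a * a) := by
    rw [functionalSegment_apply]; push_cast; ring
  rw [e]
  exact add_nonneg (mul_nonneg (by exact_mod_cast sub_nonneg.2 h₁) (hμ.2 a))
    (mul_nonneg (by exact_mod_cast h₀) (hν.2 a))

theorem continuous_functionalSegment (μ ν : WeakDual ℂ A) :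
    Continuous (functionalSegment μ ν) := by
  unfold functionalSegment
  fun_prop

theorem mongeKantorovich_functionalSegment (L : A → ℝ≥0∞) (μ ν : WeakDual ℂ A) (t : ℝ) :
    mongeKantorovich L μ (functionalSegment μ ν t) = ‖(t : ℂ)‖ₑ * mongeKantorovich L μ ν := by
  simp only [mongeKantorovich, ENNReal.mul_iSup]
  refine iSup_congr fun a => iSup_congr fun _ => ?_
  rw [← enorm_mul, functionalSegment_apply]
  congr 1
  ring

/-- The Monge-Kantorovich metric of a Lip-norm is finite on states. -/
theorem IsLipNorm.mongeKantorovich_ne_top {L : A → ℝ≥0∞} (hL : IsLipNorm L)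
    (μ ν : StateSpace A) : mongeKantorovich L μ ν ≠ ∞ := by
  intro htop
  -- By the triangle inequality, the points at finite distance from `μ` contain a unit ball around
  -- each of their members, hence form a weak* open set.
  let U : Set (StateSpace A) := {κ | mongeKantorovich L μ κ < ∞}
  have hU : IsOpen U := (hL.isOpen_iff U).2 fun κ hκ => ⟨1, one_pos, fun κ' h =>
    (mongeKantorovich_triangle L μ κ κ').trans_lt
      (ENNReal.add_lt_top.2 ⟨hκ, h.trans ENNReal.one_lt_top⟩)⟩
  let s : Set.Icc (0 : ℝ) 1 → StateSpace A := fun t =>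
    ⟨functionalSegment μ ν t, functionalSegment_mem μ.2 ν.2 t.2.1 t.2.2⟩
  have hs : Continuous s :=
    ((continuous_functionalSegment μ.1 ν.1).comp continuous_subtype_val).subtype_mk _
  -- The distance from `μ` to `s t` is `t * ∞`, which is finite only at `t = 0`, where `0 * ∞ = 0`.
  have key : ∀ t, s t ∈ U ↔ t = 0 := by
    intro t
    change mongeKantorovich L μ (functionalSegment μ ν t) < ∞ ↔ _
    rw [mongeKantorovich_functionalSegment, htop]
    constructor
    · intro h
      by_contra ht
      have : ‖((t : ℝ) : ℂ)‖ₑ ≠ 0 :=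
        enorm_ne_zero.2 (Complex.ofReal_ne_zero.2 fun h₀ => ht (Subtype.ext h₀))
      rw [ENNReal.mul_top this] at h
      exact lt_irrefl _ h
    · rintro rfl
      rw [Set.Icc.coe_zero, Complex.ofReal_zero, enorm_zero, zero_mul]
      exact ENNReal.zero_lt_top
  have hpre : s ⁻¹' U = {0} := Set.ext key
  have hopen : IsOpen ({0} : Set (Set.Icc (0 : ℝ) 1)) := hpre ▸ hU.preimage hs
  -- The singleton `{0}` would be clopen in the connected interval `[0, 1]`.
  have huniv := (show IsClopen ({0} : Set (Set.Icc (0 : ℝ) 1)) from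
    ⟨isClosed_singleton, hopen⟩).eq_univ (Set.singleton_nonempty _)
  have h1 : (1 : Set.Icc (0 : ℝ) 1) ∈ ({0} : Set (Set.Icc (0 : ℝ) 1)) := huniv ▸ Set.mem_univ _
  exact one_ne_zero (Set.mem_singleton_iff.1 h1)

/-- Functionals at Monge-Kantorovich distance `0` are equal. -/
theorem IsLipschitzSeminorm.eq_of_mongeKantorovich_eq_zero {L : A → ℝ≥0∞}
    (hL : IsLipschitzSeminorm L) {μ ν : WeakDual ℂ A} (h : mongeKantorovich L μ ν = 0) :
    μ = ν := by
  refine DFunLike.coe_injective (Continuous.ext_on hL.dense_dom (map_continuous μ)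
    (map_continuous ν) fun a ha => ?_)
  simp only [mongeKantorovich, ENNReal.iSup_eq_zero] at h
  -- Dividing `a` by `L a + 1` brings it into the unit ball of `L` without a separate case for `L a
  -- = 0`.
  have hr : (0 : ℝ) < (L a).toReal + 1 := by positivity
  have hc : (((L a).toReal + 1 : ℝ) : ℂ)⁻¹ ≠ 0 := inv_ne_zero (by exact_mod_cast hr.ne')
  have hle : L ((((L a).toReal + 1 : ℝ) : ℂ)⁻¹ • a) ≤ 1 := by
    rw [hL.smul, ← ofReal_norm, norm_inv, Complex.norm_real, Real.norm_of_nonneg hr.le]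
    nth_rw 2 [← ENNReal.ofReal_toReal (ne_of_lt ha)]
    rw [← ENNReal.ofReal_mul (by positivity), ← ENNReal.ofReal_one]
    refine ENNReal.ofReal_le_ofReal ?_
    rw [inv_mul_le_iff₀ hr]
    linarith
  have := h _ hle
  rw [map_smul, map_smul, ← smul_sub, enorm_eq_zero, smul_eq_zero] at this
  exact sub_eq_zero.1 (this.resolve_left hc)

/-- The pullback of a functional along a unital star homomorphism between universes. -/
def functionalComp {B : Type v} [CStarAlgebra B] (f : A →⋆ₐ[ℂ] B) (μ : WeakDual ℂ B) :
    WeakDual ℂ A :=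
  StrongDual.toWeakDual ((WeakDual.toStrongDual μ).comp
    { toLinearMap := f.toAlgHom.toLinearMap
      cont := InductiveLimit.continuous_starAlgHom f })

theorem functionalComp_apply {B : Type v} [CStarAlgebra B] (f : A →⋆ₐ[ℂ] B) (μ : WeakDual ℂ B)
    (a : A) : functionalComp f μ a = μ (f a) := rfl

theorem functionalComp_mem {B : Type v} [CStarAlgebra B] (f : A →⋆ₐ[ℂ] B) {μ : WeakDual ℂ B}
    (hμ : μ ∈ StateSpace B) : functionalComp f μ ∈ StateSpace A :=
  ⟨by rw [functionalComp_apply, map_one, hμ.1], fun a => by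
    rw [functionalComp_apply, map_mul, map_star]; exact hμ.2 _⟩

theorem pullback_mem {B : Type u} [CStarAlgebra B] (f : A →⋆ₐ[ℂ] B) {μ : WeakDual ℂ B}
    (hμ : μ ∈ StateSpace B) : pullback f μ ∈ StateSpace A :=
  functionalComp_mem f hμ

end States

/-! ### The limit metric and the limit seminorm -/

section LimitSeminorm

universe u v

variable {A : ℕ → Type u} [∀ n, CStarAlgebra (A n)] {L : ∀ n, A n → ℝ≥0∞}
  {φ : ∀ n, A n →⋆ₐ[ℂ] A (n + 1)}

theorem tsum_two_inv_pow_succ_mul (c : ℝ≥0∞) : ∑' n : ℕ, (2⁻¹ : ℝ≥0∞) ^ (n + 1) * c = c := by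
  rw [ENNReal.tsum_mul_right, ENNReal.tsum_geometric_add_one, ENNReal.one_sub_inv_two, inv_inv,
    ENNReal.inv_mul_cancel two_ne_zero ENNReal.ofNat_ne_top, one_mul]

/-- The limit metric is bounded by any common bound of the metrics on the `A_n`. -/
theorem limitMetric_le {μ ν : WeakDual ℂ (InductiveLimit φ)} {c : ℝ≥0∞}
    (h : ∀ n, mongeKantorovich (L n) (pullback (InductiveLimit.of φ n) μ)
      (pullback (InductiveLimit.of φ n) ν) ≤ c) : limitMetric L φ μ ν ≤ c := by
  rw [← tsum_two_inv_pow_succ_mul c]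
  refine ENNReal.tsum_le_tsum fun n => mul_le_mul_right ?_ _
  -- This is `x / (1 + x) ≤ x`, applied termwise after writing `c` as the sum of its weighted
  -- copies.
  exact (ENNReal.div_le_of_le_mul (le_mul_of_one_le_right' le_self_add)).trans (h n)

/-- Since `x / (1 + x) ≤ 1`, the series is bounded by the sum `1` of its weights. -/
theorem limitMetric_ne_top (μ ν : WeakDual ℂ (InductiveLimit φ)) : limitMetric L φ μ ν ≠ ∞ := by
  refine ne_top_of_le_ne_top ENNReal.one_ne_top ?_
  rw [← tsum_two_inv_pow_succ_mul 1]
  refine ENNReal.tsum_le_tsum fun n => mul_le_mul_right ?_ _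
  exact ENNReal.div_le_of_le_mul (by rw [one_mul]; exact le_add_self)

/-- States of the inductive limit at distance `0` are equal. -/
theorem eq_of_limitMetric_eq_zero (hL : ∀ n, IsLipNorm (L n))
    {μ ν : WeakDual ℂ (InductiveLimit φ)} (hμ : μ ∈ StateSpace (InductiveLimit φ))
    (hν : ν ∈ StateSpace (InductiveLimit φ)) (h : limitMetric L φ μ ν = 0) : μ = ν := by
  rw [limitMetric, ENNReal.tsum_eq_zero] at h
  refine DFunLike.coe_injective (Continuous.ext_on InductiveLimit.dense_iUnion_range_of
    (map_continuous μ) (map_continuous ν) fun x hx => ?_)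
  obtain ⟨n, a, rfl⟩ := Set.mem_iUnion.1 hx
  -- Finiteness is essential: in `ℝ≥0∞` the quotient `∞ / (1 + ∞)` is `0`, so a vanishing term alone
  -- would not exclude infinite distance.
  have hfin := (hL n).mongeKantorovich_ne_top ⟨_, pullback_mem (InductiveLimit.of φ n) hμ⟩
    ⟨_, pullback_mem (InductiveLimit.of φ n) hν⟩
  have hn := (mul_eq_zero.1 (h n)).resolve_left (pow_ne_zero _ (by simp))
  rw [ENNReal.div_eq_zero_iff] at hn
  have hz := hn.resolve_right (ENNReal.add_ne_top.2 ⟨ENNReal.one_ne_top, hfin⟩)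
  exact DFunLike.congr_fun ((hL n).eq_of_mongeKantorovich_eq_zero hz) a

/-- A state difference is controlled by the limit seminorm and the limit metric. -/
theorem enorm_sub_le_limitSeminorm_mul (hL : ∀ n, IsLipNorm (L n))
    {μ ν : WeakDual ℂ (InductiveLimit φ)} (hμ : μ ∈ StateSpace (InductiveLimit φ))
    (hν : ν ∈ StateSpace (InductiveLimit φ)) (a : InductiveLimit φ) :
    ‖μ a - ν a‖ₑ ≤ limitSeminorm L φ a * limitMetric L φ μ ν := by
  by_cases hne : μ = ν
  · simp [hne]
  -- Clearing the denominator in `ℝ≥0∞` needs `ρ(μ, ν)` to be neither `0` nor `∞`.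
  · refine (ENNReal.div_le_iff (fun h => hne (eq_of_limitMetric_eq_zero hL hμ hν h))
      (limitMetric_ne_top μ ν)).1 ?_
    exact le_iSup_of_le ⟨μ, hμ⟩ (le_iSup_of_le ⟨ν, hν⟩
      (le_iSup_of_le (fun h => hne (congrArg Subtype.val h)) le_rfl))

variable {B : ℕ → Type v} [∀ n, CStarAlgebra (B n)] {M : ∀ n, B n → ℝ≥0∞}
  {θ : ∀ n, B n →⋆ₐ[ℂ] B (n + 1)}

/-- A homomorphism of inductive limits whose restrictions to all `A_n` are `K`-Lipschitz is
`K`-Lipschitz for the limit seminorms. -/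
theorem limitSeminorm_map_le (hL : ∀ n, IsLipNorm (L n)) (hM : ∀ n, IsLipNorm (M n))
    (f : InductiveLimit φ →⋆ₐ[ℂ] InductiveLimit θ) (K : ℝ≥0)
    (hf : ∀ n a, limitSeminorm M θ (f (InductiveLimit.of φ n a)) ≤ K * L n a)
    (a : InductiveLimit φ) : limitSeminorm M θ (f a) ≤ K * limitSeminorm L φ a := by
  refine iSup_le fun μ => iSup_le fun ν => iSup_le fun _ => ENNReal.div_le_of_le_mul ?_
  have hmetric : limitMetric L φ (functionalComp f μ.1) (functionalComp f ν.1) ≤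
      K * limitMetric M θ μ.1 ν.1 := by
    -- The bound `K ρ(μ, ν)` is uniform in `n`; it comes from evaluating the two states at `f (φ^n
    -- x)`, whose limit seminorm is at most `K` when `L n x ≤ 1`.
    refine limitMetric_le fun n => iSup₂_le fun x hx => ?_
    refine (enorm_sub_le_limitSeminorm_mul hM μ.2 ν.2 (f (InductiveLimit.of φ n x))).trans ?_
    refine mul_le_mul_left ((hf n x).trans ?_) _
    simpa using mul_le_mul_right hx (K : ℝ≥0∞)
  calc ‖μ.1 (f a) - ν.1 (f a)‖ₑ
      ≤ limitSeminorm L φ a * limitMetric L φ (functionalComp f μ.1) (functionalComp f ν.1) :=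
        enorm_sub_le_limitSeminorm_mul hL (functionalComp_mem f μ.2) (functionalComp_mem f ν.2) a
    _ ≤ limitSeminorm L φ a * (K * limitMetric M θ μ.1 ν.1) := mul_le_mul_right hmetric _
    _ = K * limitSeminorm L φ a * limitMetric M θ μ.1 ν.1 := by ring

end LimitSeminorm

/-! ### The isomorphism of the two limits -/

theorem BddAbove.range_mul_nnreal {f g : ℕ → ℝ≥0} (hf : BddAbove (Set.range f))
    (hg : BddAbove (Set.range g)) : BddAbove (Set.range fun n => f n * g n) := by
  obtain ⟨c, hc⟩ := hf
  obtain ⟨d, hd⟩ := hg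
  refine ⟨c * d, ?_⟩
  rintro _ ⟨n, rfl⟩
  exact mul_le_mul' (hc ⟨n, rfl⟩) (hd ⟨n, rfl⟩)

end

theorem corollary4p8
    {A : ℕ → Type*} [∀ n, CStarAlgebra (A n)] {B : ℕ → Type*} [∀ n, CStarAlgebra (B n)]
    (LA : ∀ n, A n → ℝ≥0∞) (LB : ∀ n, B n → ℝ≥0∞)
    (φ : ∀ n, A n →⋆ₐ[ℂ] A (n + 1)) (θ : ∀ n, B n →⋆ₐ[ℂ] B (n + 1))
    (hA : IsInductiveSequence LA φ) (hB : IsInductiveSequence LB θ)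
    (ψ : ∀ n, A n →⋆ₐ[ℂ] B n) (Ψ : ∀ n, B n →⋆ₐ[ℂ] A (n + 1))
    (hΨψ : ∀ n, (Ψ n).comp (ψ n) = φ n) (hψΨ : ∀ n, (ψ (n + 1)).comp (Ψ n) = θ n)
    (lam gam alp bet : ℕ → ℝ≥0)
    (hlam : BddAbove (Set.range lam)) (hgam : BddAbove (Set.range gam))
    (halp : BddAbove (Set.range alp)) (hbet : BddAbove (Set.range bet))
    (hLψ : ∀ n a, LB n (ψ n a) ≤ lam n * LA n a)
    (hLθ : ∀ n b, limitSeminorm LB θ (InductiveLimit.of θ n b) ≤ gam n * LB n b)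
    (hLΨ : ∀ n b, LA (n + 1) (Ψ n b) ≤ alp n * LB n b)
    (hLφ : ∀ n a, limitSeminorm LA φ (InductiveLimit.of φ n a) ≤ bet n * LA n a) :
    ∃ (ψ' : InductiveLimit φ →⋆ₐ[ℂ] InductiveLimit θ)
      (Ψ' : InductiveLimit θ →⋆ₐ[ℂ] InductiveLimit φ),
      (ψ'.comp Ψ' = StarAlgHom.id ℂ (InductiveLimit θ) ∧
        Ψ'.comp ψ' = StarAlgHom.id ℂ (InductiveLimit φ)) ∧
      (∀ n, ψ'.comp (InductiveLimit.of φ n) = (InductiveLimit.of θ n).comp (ψ n) ∧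
        Ψ'.comp (InductiveLimit.of θ n) = (InductiveLimit.of φ (n + 1)).comp (Ψ n)) ∧
      (∀ a, limitSeminorm LB θ (ψ' a) ≤
        2 * ((⨆ n, lam n * gam n : ℝ≥0) : ℝ≥0∞) * limitSeminorm LA φ a) ∧
      (∀ b, limitSeminorm LA φ (Ψ' b) ≤
        2 * ((⨆ n, alp n * bet (n + 1) : ℝ≥0) : ℝ≥0∞) * limitSeminorm LB θ b) := by
  have hg : ∀ n a, (InductiveLimit.of θ (n + 1)).comp (ψ (n + 1)) (φ n a) =
      (InductiveLimit.of θ n).comp (ψ n) a := by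
    intro n a
    -- The ladder commutes: `ψ (n + 1) ∘ φ n = ψ (n + 1) ∘ Ψ n ∘ ψ n = θ n ∘ ψ n`.
    have h := DFunLike.congr_fun (hψΨ n) (ψ n a)
    simp only [StarAlgHom.comp_apply] at h ⊢
    rw [← hΨψ n, StarAlgHom.comp_apply, h, InductiveLimit.of_succ_apply]
  have hk : ∀ n b, (InductiveLimit.of φ (n + 1 + 1)).comp (Ψ (n + 1)) (θ n b) =
      (InductiveLimit.of φ (n + 1)).comp (Ψ n) b := by
    intro n b
    have h := DFunLike.congr_fun (hΨψ (n + 1)) (Ψ n b)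
    simp only [StarAlgHom.comp_apply] at h ⊢
    rw [← hψΨ n, StarAlgHom.comp_apply, h, InductiveLimit.of_succ_apply]
  let f := InductiveLimit.lift (g := fun n => (InductiveLimit.of θ n).comp (ψ n)) hg
  let g := InductiveLimit.lift (g := fun n => (InductiveLimit.of φ (n + 1)).comp (Ψ n)) hk
  have hf_of : ∀ n a, f (InductiveLimit.of φ n a) = InductiveLimit.of θ n (ψ n a) :=
    InductiveLimit.lift_of hg
  have hg_of : ∀ n b, g (InductiveLimit.of θ n b) = InductiveLimit.of φ (n + 1) (Ψ n b) :=
    InductiveLimit.lift_of hk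
  -- The argument yields the bounds with constant `1`; the factor 2 is slack.
  have two_mul_bound : ∀ x y : ℝ≥0∞, x * y ≤ 2 * x * y := fun x y => by
    rw [mul_assoc]
    exact le_mul_of_one_le_left' one_le_two
  refine ⟨f, g, ⟨InductiveLimit.starAlgHom_ext fun n b => ?_,
    InductiveLimit.starAlgHom_ext fun n a => ?_⟩,
    fun n => ⟨StarAlgHom.ext (hf_of n), StarAlgHom.ext (hg_of n)⟩, fun a => ?_, fun b => ?_⟩
  · have h := DFunLike.congr_fun (hψΨ n) b
    simp only [StarAlgHom.comp_apply, StarAlgHom.coe_id, id] at h ⊢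
    rw [hg_of, hf_of, h, InductiveLimit.of_succ_apply]
  · have h := DFunLike.congr_fun (hΨψ n) a
    simp only [StarAlgHom.comp_apply, StarAlgHom.coe_id, id] at h ⊢
    rw [hf_of, hg_of, h, InductiveLimit.of_succ_apply]
  · refine (limitSeminorm_map_le hA.isLipNorm hB.isLipNorm f _ (fun n x => ?_) a).trans
      (two_mul_bound _ _)
    rw [hf_of]
    -- Boundedness matters because the supremum is taken in `ℝ≥0`, where an unbounded family has the
    -- default supremum `0`.
    have hle : lam n * gam n ≤ ⨆ n, lam n * gam n := le_ciSup (hlam.range_mul_nnreal hgam) n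
    calc limitSeminorm LB θ (InductiveLimit.of θ n (ψ n x))
        ≤ gam n * LB n (ψ n x) := hLθ n _
      _ ≤ gam n * (lam n * LA n x) := mul_le_mul_right (hLψ n x) _
      _ = ((lam n * gam n : ℝ≥0) : ℝ≥0∞) * LA n x := by push_cast; ring
      _ ≤ _ := mul_le_mul_left (ENNReal.coe_le_coe.2 hle) _
  · refine (limitSeminorm_map_le hB.isLipNorm hA.isLipNorm g _ (fun n x => ?_) b).trans
      (two_mul_bound _ _)
    rw [hg_of]
    -- `Ψ n` lands in `A (n + 1)`, so `alp n` is paired with the shifted constant `bet (n + 1)`.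
    have hbet' : BddAbove (Set.range fun n => bet (n + 1)) :=
      hbet.mono (Set.range_comp_subset_range (· + 1) bet)
    have hle : alp n * bet (n + 1) ≤ ⨆ n, alp n * bet (n + 1) :=
      le_ciSup (halp.range_mul_nnreal hbet') n
    calc limitSeminorm LA φ (InductiveLimit.of φ (n + 1) (Ψ n x))
        ≤ bet (n + 1) * LA (n + 1) (Ψ n x) := hLφ (n + 1) _
      _ ≤ bet (n + 1) * (alp n * LB n x) := mul_le_mul_right (hLΨ n x) _
      _ = ((alp n * bet (n + 1) : ℝ≥0) : ℝ≥0∞) * LB n x := by push_cast; ring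
      _ ≤ _ := mul_le_mul_left (ENNReal.coe_le_coe.2 hle) _
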